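/- Let $R$ be an associative ring with unity which is right coherent (every finitely generated right ideal is finitely presented). Then $$\mathcal{DP} = \mathcal{PGF} = \mathcal{GP}_{ac}$$ as classes of left $R$-modules, where each class consists of the modules isomorphic to a module of cycles of some exact complex $P = \cdots \to P_1 \to P_0 \to P_{-1} \to \cdots$ of projective left $R$-modules, such that - for $\mathcal{DP}$ (Ding projective modules): $\operatorname{Hom}_R(P,F)$ is exact for every flat left $R$-module $F$; - for $\mathcal{PGF}$ (projectively coresolved Gorenstein flat modules): $A \otimes_R P$ is exact for every injective right $R$-module $A$; - for $\mathcal{GP}_{ac}$ (Gorenstein AC-projective modules): $\operatorname{Hom}_R(P,L)$ is exact for every level left $R$-module $L$. Here a left $R$-module $L$ is level if $\operatorname{Tor}_1^R(M,L)=0$ for every right $R$-module $M$ of type $FP_\infty$, i.e. every right $R$-module $M$ having a resolution $\cdots \to P_1 \to P_0 \to M \to 0$ by finitely generated projective right $R$-modules. -/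

import Mathlib

universe u

open scoped TensorProduct

/-! Left modules over a (not necessarily commutative) ring `R` are modules over `R`; right
`R`-modules are modules over `Rᵐᵒᵖ`, with `m * r` written `MulOpposite.op r • m`. -/

namespace DingPGF

section Tensor

variable (R : Type u) [Ring R]

/-- The subgroup of `M ⊗_ℤ N` generated by the relations `(m r) ⊗ n = m ⊗ (r n)`. -/
def balancedRelations (M N : Type u) [AddCommGroup M] [Module Rᵐᵒᵖ M]
    [AddCommGroup N] [Module R N] : AddSubgroup (M ⊗[ℤ] N) :=
  AddSubgroup.closure
    {t | ∃ (m : M) (r : R) (n : N), t = (MulOpposite.op r • m) ⊗ₜ[ℤ] n - m ⊗ₜ[ℤ] (r • n)}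

/-- The tensor product `M ⊗_R N` of a right `R`-module `M` and a left `R`-module `N`,
an abelian group. -/
def Tensor (M N : Type u) [AddCommGroup M] [Module Rᵐᵒᵖ M]
    [AddCommGroup N] [Module R N] : Type u :=
  (M ⊗[ℤ] N) ⧸ balancedRelations R M N

instance (M N : Type u) [AddCommGroup M] [Module Rᵐᵒᵖ M] [AddCommGroup N] [Module R N] :
    AddCommGroup (Tensor R M N) :=
  inferInstanceAs (AddCommGroup ((M ⊗[ℤ] N) ⧸ balancedRelations R M N))

variable {M M' N N' : Type u} [AddCommGroup M] [Module Rᵐᵒᵖ M] [AddCommGroup M'] [Module Rᵐᵒᵖ M']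
  [AddCommGroup N] [Module R N] [AddCommGroup N'] [Module R N']

/-- The additive map `M ⊗_ℤ N → M' ⊗_ℤ N'` induced by `f` and `g`. -/
def intMap (f : M →ₗ[Rᵐᵒᵖ] M') (g : N →ₗ[R] N') : M ⊗[ℤ] N →+ M' ⊗[ℤ] N' :=
  (TensorProduct.map f.toAddMonoidHom.toIntLinearMap
    g.toAddMonoidHom.toIntLinearMap).toAddMonoidHom

@[simp] theorem intMap_tmul (f : M →ₗ[Rᵐᵒᵖ] M') (g : N →ₗ[R] N') (m : M) (n : N) :
    intMap R f g (m ⊗ₜ[ℤ] n) = f m ⊗ₜ[ℤ] g n := rfl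

theorem balancedRelations_le_comap (f : M →ₗ[Rᵐᵒᵖ] M') (g : N →ₗ[R] N') :
    balancedRelations R M N ≤ (balancedRelations R M' N').comap (intMap R f g) := by
  refine (AddSubgroup.closure_le _).2 ?_
  rintro _ ⟨m, r, n, rfl⟩
  refine AddSubgroup.subset_closure ⟨f m, r, g n, ?_⟩
  simp

/-- The map `f ⊗ g : M ⊗_R N → M' ⊗_R N'`. -/
def Tensor.map (f : M →ₗ[Rᵐᵒᵖ] M') (g : N →ₗ[R] N') : Tensor R M N →+ Tensor R M' N' :=
  QuotientAddGroup.map (balancedRelations R M N) (balancedRelations R M' N') (intMap R f g)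
    (balancedRelations_le_comap R f g)

end Tensor

/-- A left `R`-module `N` is flat: `- ⊗_R N` preserves injections of right `R`-modules. -/
def IsFlat (R : Type u) [Ring R] (N : Type u) [AddCommGroup N] [Module R N] : Prop :=
  ∀ (A B : Type u) [AddCommGroup A] [Module Rᵐᵒᵖ A] [AddCommGroup B] [Module Rᵐᵒᵖ B]
    (f : A →ₗ[Rᵐᵒᵖ] B), Function.Injective f →
      Function.Injective (Tensor.map R f (LinearMap.id : N →ₗ[R] N))

/-- `R` is right coherent: every finitely generated right ideal is finitely presented. -/
def IsRightCoherent (R : Type u) [Ring R] : Prop :=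
  ∀ I : Submodule Rᵐᵒᵖ R, I.FG → Module.FinitePresentation Rᵐᵒᵖ I

/-- A projective resolution `⋯ → P 1 → P 0 → M → 0` of a module `M` over a ring `S`. -/
structure ProjRes (S : Type u) [Ring S] (M : Type u) [AddCommGroup M] [Module S M] where
  P : ℕ → Type u
  [addCommGroup : ∀ i, AddCommGroup (P i)]
  [module : ∀ i, Module S (P i)]
  projective : ∀ i, Module.Projective S (P i)
  d : ∀ i, P (i + 1) →ₗ[S] P i
  ε : P 0 →ₗ[S] M
  exact_d : ∀ i, Function.Exact (d (i + 1)) (d i)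
  exact_ε : Function.Exact (d 0) ε
  surjective_ε : Function.Surjective ε

attribute [instance] ProjRes.addCommGroup ProjRes.module

/-- `M` is of type `FP_∞`: it has a projective resolution by finitely generated modules. -/
def IsFPInfty (S : Type u) [Ring S] (M : Type u) [AddCommGroup M] [Module S M] : Prop :=
  ∃ P : ProjRes S M, ∀ i, Module.Finite S (P.P i)

/-- `Tor_1^R(M, N) = 0` for a right module `M` and a left module `N`: for every projective
resolution `P` of `M`, the complex `P ⊗_R N` has zero homology in degree one. -/
def TorOneVanishes (R : Type u) [Ring R] (M : Type u) [AddCommGroup M] [Module Rᵐᵒᵖ M]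
    (N : Type u) [AddCommGroup N] [Module R N] : Prop :=
  ∀ P : ProjRes Rᵐᵒᵖ M,
    Function.Exact (Tensor.map R (P.d 1) (LinearMap.id : N →ₗ[R] N))
      (Tensor.map R (P.d 0) (LinearMap.id : N →ₗ[R] N))

/-- A left `R`-module `N` is level: `Tor_1^R(M, N) = 0` for all right modules `M` of type
`FP_∞`. -/
def IsLevel (R : Type u) [Ring R] (N : Type u) [AddCommGroup N] [Module R N] : Prop :=
  ∀ (M : Type u) [AddCommGroup M] [Module Rᵐᵒᵖ M], IsFPInfty Rᵐᵒᵖ M → TorOneVanishes R M N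

/-- An exact complex `⋯ → X (i + 1) → X i → X (i - 1) → ⋯`, indexed by all integers, of
projective left `R`-modules. -/
structure ExactProjComplex (R : Type u) [Ring R] where
  X : ℤ → Type u
  [addCommGroup : ∀ i, AddCommGroup (X i)]
  [module : ∀ i, Module R (X i)]
  projective : ∀ i, Module.Projective R (X i)
  d : ∀ i, X (i + 1) →ₗ[R] X i
  exact_d : ∀ i, Function.Exact (d (i + 1)) (d i)

attribute [instance] ExactProjComplex.addCommGroup ExactProjComplex.module

namespace ExactProjComplex

variable {R : Type u} [Ring R]

/-- The complex `Hom_R(X, L)` is exact. -/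
def HomExact (C : ExactProjComplex R) (L : Type u) [AddCommGroup L] [Module R L] : Prop :=
  ∀ i, Function.Exact (fun f : C.X i →ₗ[R] L => f ∘ₗ C.d i)
    (fun f : C.X (i + 1) →ₗ[R] L => f ∘ₗ C.d (i + 1))

/-- The complex `A ⊗_R X` is exact. -/
def TensorExact (C : ExactProjComplex R) (A : Type u) [AddCommGroup A] [Module Rᵐᵒᵖ A] : Prop :=
  ∀ i, Function.Exact (Tensor.map R (LinearMap.id : A →ₗ[Rᵐᵒᵖ] A) (C.d (i + 1)))
    (Tensor.map R (LinearMap.id : A →ₗ[Rᵐᵒᵖ] A) (C.d i))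

/-- `M` is (isomorphic to) a module of cycles of the complex. -/
def IsCycleOf (C : ExactProjComplex R) (M : Type u) [AddCommGroup M] [Module R M] : Prop :=
  ∃ i, Nonempty (M ≃ₗ[R] LinearMap.ker (C.d i))

end ExactProjComplex

variable (R : Type u) [Ring R] (M : Type u) [AddCommGroup M] [Module R M]

/-- Ding projective left `R`-modules. -/
def IsDingProjective : Prop :=
  ∃ C : ExactProjComplex R, C.IsCycleOf M ∧
    ∀ (F : Type u) [AddCommGroup F] [Module R F], IsFlat R F → C.HomExact F

/-- Projectively coresolved Gorenstein flat left `R`-modules. -/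
def IsPGF : Prop :=
  ∃ C : ExactProjComplex R, C.IsCycleOf M ∧
    ∀ (A : Type u) [AddCommGroup A] [Module Rᵐᵒᵖ A], Module.Injective Rᵐᵒᵖ A → C.TensorExact A

/-- Gorenstein AC-projective left `R`-modules. -/
def IsGorensteinACProjective : Prop :=
  ∃ C : ExactProjComplex R, C.IsCycleOf M ∧
    ∀ (L : Type u) [AddCommGroup L] [Module R L], IsLevel R L → C.HomExact L

/-- The class of Ding projective left `R`-modules. -/
def DP : Set (ModuleCat.{u} R) := {M | IsDingProjective R M}

/-- The class of projectively coresolved Gorenstein flat left `R`-modules. -/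
def PGF : Set (ModuleCat.{u} R) := {M | IsPGF R M}

/-- The class of Gorenstein AC-projective left `R`-modules. -/
def GPac : Set (ModuleCat.{u} R) := {M | IsGorensteinACProjective R M}

end DingPGF

/-! Write X⁺ for the character module Hom_ℤ(X, ℚ/ℤ). Each of the three classes is cut out by a
condition on an exact complex P of projectives, and over a right coherent ring the three conditions
on P are equivalent, so the same complexes serve as witnesses.

Level means flat (`isLevel_iff_isFlat`): coherence gives R/I a resolution by finite free modules for
every finitely generated right ideal I, and Tor₁ against these R/I detects flatness.

The link between ⊗ and Hom is (A ⊗ P)⁺ = Hom(P, A⁺), so A ⊗ P is exact iff Hom(P, A⁺) is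
(`tensorExact_iff`). If A is injective, A⁺ is flat by coherence (`isFlat_LDual`), which gives one
implication.

For the other, let F be flat. Then F⁺ is injective, so Hom(P, F⁺⁺) is exact, and F⁺⁺/F is flat again
(`isFlat_EvalCoker`). Iterating gives a pure exact complex 0 → F → F⁺⁺ → F₁⁺⁺ → ⋯. A cocycle g of
Hom(P, F) extends to a chain map from a truncation of P to it, because every Hom(P, Fⱼ⁺⁺) is exact.
Any such chain map is null-homotopic (`exists_homotopy_of_projective`), and the homotopy in degree 0
writes g as a coboundary. -/

namespace DingPGF

/-! ### Characters of abelian groups -/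

/-- The divisible cogenerator `ℚ / ℤ` of abelian groups. -/
abbrev QZ : Type := AddCircle (1 : ℚ)

theorem exists_character_ne_zero {A : Type*} [AddCommGroup A] {a : A} (ha : a ≠ 0) :
    ∃ c : A →+ QZ, c a ≠ 0 :=
  CharacterModule.exists_character_apply_ne_zero_of_ne_zero ha

theorem exists_character_separating {A : Type*} [AddCommGroup A] (B : AddSubgroup A) {a : A}
    (ha : a ∉ B) : ∃ c : A →+ QZ, (∀ b ∈ B, c b = 0) ∧ c a ≠ 0 := by
  obtain ⟨c, hc⟩ := exists_character_ne_zero (a := QuotientAddGroup.mk' B a)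
    (by simpa using ha)
  refine ⟨c.comp (QuotientAddGroup.mk' B), fun b hb => ?_, hc⟩
  have : QuotientAddGroup.mk' B b = 0 := by simpa using hb
  rw [AddMonoidHom.comp_apply, this, map_zero]

theorem exists_character_extension {A : Type*} {B : Type*} [AddCommGroup A] [AddCommGroup B]
    (f : A →+ B) (hf : Function.Injective f) (c : A →+ QZ) : ∃ c' : B →+ QZ, c'.comp f = c :=
  CharacterModule.dual_surjective_of_injective f.toIntLinearMap hf c

theorem exists_character_factor {A : Type*} {B : Type*} [AddCommGroup A] [AddCommGroup B]
    (f : A →+ B) (c : A →+ QZ) (h : ∀ a, f a = 0 → c a = 0) : ∃ c' : B →+ QZ, ∀ a, c' (f a) = c a := by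
  have hk : f.ker ≤ c.ker := fun a ha => h a ha
  obtain ⟨c', hc'⟩ := exists_character_extension (QuotientAddGroup.kerLift f)
    (QuotientAddGroup.kerLift_injective f) (QuotientAddGroup.lift f.ker c hk)
  refine ⟨c', fun a => ?_⟩
  have := DFunLike.congr_fun hc' (QuotientAddGroup.mk a)
  simpa using this

/-- Exactness of a complex of abelian groups is detected by characters. -/
theorem exact_iff_character {A B C : Type*} [AddCommGroup A] [AddCommGroup B] [AddCommGroup C]
    (f : A →+ B) (g : B →+ C) (hgf : ∀ a, g (f a) = 0) :
    Function.Exact f g ↔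
      ∀ c : B →+ QZ, (∀ a, c (f a) = 0) → ∃ c' : C →+ QZ, ∀ b, c' (g b) = c b := by
  constructor
  · intro h c hc
    refine exists_character_factor g c fun b hb => ?_
    obtain ⟨a, rfl⟩ := (h b).1 hb
    exact hc a
  · intro h b
    refine ⟨fun hb => ?_, fun ⟨a, ha⟩ => ha ▸ hgf a⟩
    by_contra hn
    obtain ⟨c, hc, hcb⟩ := exists_character_separating f.range (a := b) (by simpa using hn)
    obtain ⟨c', hc'⟩ := h c fun a => hc _ ⟨a, rfl⟩
    exact hcb (by rw [← hc', hb, map_zero])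

/-! ### Character modules over a noncommutative ring -/

section Dual

variable (R : Type u) [Ring R]

/-- The character module of a left `R`-module, a right `R`-module. -/
def RDual (N : Type u) [AddCommGroup N] [Module R N] : Type u := N →+ QZ

/-- The character module of a right `R`-module, a left `R`-module. -/
def LDual (A : Type u) [AddCommGroup A] [Module Rᵐᵒᵖ A] : Type u := A →+ QZ

variable {R} {A A' N N' : Type u} [AddCommGroup A] [Module Rᵐᵒᵖ A] [AddCommGroup A']
  [Module Rᵐᵒᵖ A'] [AddCommGroup N] [Module R N] [AddCommGroup N'] [Module R N']

instance : AddCommGroup (RDual R N) := inferInstanceAs (AddCommGroup (N →+ QZ))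

instance : AddCommGroup (LDual R A) := inferInstanceAs (AddCommGroup (A →+ QZ))

instance : FunLike (RDual R N) N QZ := inferInstanceAs (FunLike (N →+ QZ) N QZ)

instance : FunLike (LDual R A) A QZ := inferInstanceAs (FunLike (A →+ QZ) A QZ)

instance : AddMonoidHomClass (RDual R N) N QZ := inferInstanceAs (AddMonoidHomClass (N →+ QZ) N QZ)

instance : AddMonoidHomClass (LDual R A) A QZ := inferInstanceAs (AddMonoidHomClass (A →+ QZ) A QZ)

@[ext] theorem RDual.ext {c c' : RDual R N} (h : ∀ x, c x = c' x) : c = c' := DFunLike.ext _ _ h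

@[ext] theorem LDual.ext {c c' : LDual R A} (h : ∀ x, c x = c' x) : c = c' := DFunLike.ext _ _ h

@[simp] theorem RDual.add_apply (c c' : RDual R N) (x : N) : (c + c') x = c x + c' x := rfl

@[simp] theorem LDual.add_apply (c c' : LDual R A) (x : A) : (c + c') x = c x + c' x := rfl

@[simp] theorem RDual.zero_apply (x : N) : (0 : RDual R N) x = 0 := rfl

@[simp] theorem LDual.zero_apply (x : A) : (0 : LDual R A) x = 0 := rfl

theorem RDual.sum_apply {ι : Type*} (s : Finset ι) (c : ι → RDual R N) (x : N) :
    (∑ i ∈ s, c i) x = ∑ i ∈ s, c i x :=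
  AddMonoidHom.finsetSum_apply (M := N) (N := QZ) c s x

theorem LDual.sum_apply {ι : Type*} (s : Finset ι) (c : ι → LDual R A) (x : A) :
    (∑ i ∈ s, c i) x = ∑ i ∈ s, c i x :=
  AddMonoidHom.finsetSum_apply (M := A) (N := QZ) c s x

instance : SMul Rᵐᵒᵖ (RDual R N) :=
  ⟨fun r c => AddMonoidHom.comp (c : N →+ QZ) (DistribSMul.toAddMonoidHom N r.unop)⟩

instance : SMul R (LDual R A) :=
  ⟨fun r c => AddMonoidHom.comp (c : A →+ QZ) (DistribSMul.toAddMonoidHom A (MulOpposite.op r))⟩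

@[simp] theorem RDual.smul_apply (r : Rᵐᵒᵖ) (c : RDual R N) (x : N) : (r • c) x = c (r.unop • x) :=
  rfl

@[simp] theorem LDual.smul_apply (r : R) (c : LDual R A) (x : A) :
    (r • c) x = c (MulOpposite.op r • x) := rfl

instance : Module Rᵐᵒᵖ (RDual R N) where
  one_smul c := by ext; simp
  mul_smul r s c := by ext; simp [mul_smul]
  smul_zero r := by ext; simp
  smul_add r c c' := by ext; simp
  add_smul r s c := by ext; simp [add_smul]
  zero_smul c := by ext; simp

instance : Module R (LDual R A) where
  one_smul c := by ext; simp
  mul_smul r s c := by ext; simp [mul_smul]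
  smul_zero r := by ext; simp
  smul_add r c c' := by ext; simp
  add_smul r s c := by ext; simp [add_smul]
  zero_smul c := by ext; simp

/-- The transpose of a map of left modules. -/
def RDual.map (f : N →ₗ[R] N') : RDual R N' →ₗ[Rᵐᵒᵖ] RDual R N where
  toFun c := AddMonoidHom.comp (c : N' →+ QZ) f.toAddMonoidHom
  map_add' _ _ := rfl
  map_smul' r c := by
    ext x
    exact congrArg c (f.map_smul r.unop x).symm

@[simp] theorem RDual.map_apply (f : N →ₗ[R] N') (c : RDual R N') (x : N) :
    RDual.map f c x = c (f x) := rfl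

/-- The character of `A ⊗_R N` with value `c m n` at `m ⊗ n`. -/
noncomputable def characterOfBalanced (c : A →+ N →+ QZ)
    (hc : ∀ m (r : R) n, c (MulOpposite.op r • m) n = c m (r • n)) : Tensor R A N →+ QZ :=
  QuotientAddGroup.lift (balancedRelations R A N)
    (TensorProduct.liftAddHom c fun k a b => by simp) <| by
      refine (AddSubgroup.closure_le _).2 ?_
      rintro _ ⟨m, r, n, rfl⟩
      simp [hc]

/-- The elementary tensor in `A ⊗_R N`. -/
def Tensor.tmul (a : A) (n : N) : Tensor R A N :=
  QuotientAddGroup.mk' (balancedRelations R A N) (a ⊗ₜ[ℤ] n)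

@[simp] theorem characterOfBalanced_tmul (c : A →+ N →+ QZ)
    (hc : ∀ m (r : R) n, c (MulOpposite.op r • m) n = c m (r • n)) (a : A) (n : N) :
    characterOfBalanced c hc (Tensor.tmul a n) = c a n := rfl

@[simp] theorem Tensor.map_tmul (f : A →ₗ[Rᵐᵒᵖ] A') (g : N →ₗ[R] N') (a : A) (n : N) :
    Tensor.map R f g (Tensor.tmul a n) = Tensor.tmul (f a) (g n) := rfl

theorem Tensor.add_tmul (a b : A) (n : N) :
    Tensor.tmul (R := R) (a + b) n = Tensor.tmul a n + Tensor.tmul b n := by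
  simp only [Tensor.tmul, TensorProduct.add_tmul]; rfl

theorem Tensor.tmul_add (a : A) (n m : N) :
    Tensor.tmul (R := R) a (n + m) = Tensor.tmul a n + Tensor.tmul a m := by
  simp only [Tensor.tmul, TensorProduct.tmul_add]; rfl

theorem Tensor.smul_tmul (a : A) (r : R) (n : N) :
    Tensor.tmul (R := R) (MulOpposite.op r • a) n = Tensor.tmul a (r • n) := by
  refine (QuotientAddGroup.eq_iff_sub_mem).2 (AddSubgroup.subset_closure ⟨a, r, n, rfl⟩)

theorem Tensor.hom_ext {B : Type*} [AddCommGroup B] {f g : Tensor R A N →+ B}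
    (h : ∀ a n, f (Tensor.tmul a n) = g (Tensor.tmul a n)) : f = g := by
  refine QuotientAddGroup.addMonoidHom_ext _ ?_
  refine AddMonoidHom.ext fun t => ?_
  induction t using TensorProduct.induction_on with
  | zero => simp
  | tmul a n => exact h a n
  | add x y hx hy => rw [map_add, map_add, hx, hy]

variable (R A N) in
/-- Elementary tensors as a biadditive map. -/
def Tensor.mk : A →+ N →+ Tensor R A N :=
  AddMonoidHom.mk' (fun a => AddMonoidHom.mk' (Tensor.tmul a) (Tensor.tmul_add a))
    fun a b => by ext n; exact Tensor.add_tmul a b n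

@[simp] theorem Tensor.zero_tmul (n : N) : Tensor.tmul (R := R) (0 : A) n = 0 :=
  DFunLike.congr_fun (map_zero (Tensor.mk R A N)) n

@[simp] theorem Tensor.tmul_zero (a : A) : Tensor.tmul (R := R) a (0 : N) = 0 :=
  map_zero (Tensor.mk R A N a)

/-- Characters of `A ⊗_R N` as linear maps from `A` to the character module of `N`. -/
noncomputable def characterEquivRight : (Tensor R A N →+ QZ) ≃ (A →ₗ[Rᵐᵒᵖ] RDual R N) where
  toFun c :=
    { toFun := fun a => c.comp (Tensor.mk R A N a)
      map_add' := fun a b => by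
        ext n; exact (congrArg c (Tensor.add_tmul a b n)).trans (map_add c _ _)
      map_smul' := fun r a => by
        ext n; exact congrArg c (Tensor.smul_tmul a r.unop n) }
  invFun φ := characterOfBalanced φ.toAddMonoidHom fun m r n => by
    change φ (MulOpposite.op r • m) n = φ m (r • n)
    rw [φ.map_smul]; rfl
  left_inv c := Tensor.hom_ext fun a n => rfl
  right_inv φ := rfl

/-- Characters of `A ⊗_R N` as linear maps from `N` to the character module of `A`. -/
noncomputable def characterEquivLeft : (Tensor R A N →+ QZ) ≃ (N →ₗ[R] LDual R A) where
  toFun c :=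
    { toFun := fun n => c.comp ((Tensor.mk R A N).flip n)
      map_add' := fun n m => by
        ext a; exact (congrArg c (Tensor.tmul_add a n m)).trans (map_add c _ _)
      map_smul' := fun r n => by
        ext a; exact congrArg c (Tensor.smul_tmul a r n).symm }
  invFun φ := characterOfBalanced (AddMonoidHom.flip (φ.toAddMonoidHom : N →+ A →+ QZ))
    fun m r n => by
      change φ n (MulOpposite.op r • m) = φ (r • n) m
      rw [φ.map_smul]; rfl
  left_inv c := Tensor.hom_ext fun a n => rfl
  right_inv φ := rfl

@[simp] theorem characterEquivRight_apply (c : Tensor R A N →+ QZ) (a : A) (n : N) :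
    characterEquivRight c a n = c (Tensor.tmul a n) := rfl

@[simp] theorem characterEquivLeft_apply (c : Tensor R A N →+ QZ) (a : A) (n : N) :
    characterEquivLeft c n a = c (Tensor.tmul a n) := rfl

@[simp] theorem characterEquivRight_symm_tmul (φ : A →ₗ[Rᵐᵒᵖ] RDual R N) (a : A) (n : N) :
    characterEquivRight.symm φ (Tensor.tmul a n) = φ a n := rfl

@[simp] theorem characterEquivLeft_symm_tmul (φ : N →ₗ[R] LDual R A) (a : A) (n : N) :
    characterEquivLeft.symm φ (Tensor.tmul a n) = φ n a := rfl

/-- Tensoring a complex of right modules with `N` is exact if and only if mapping it to the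
character module of `N` is. -/
theorem exact_map_id_iff {A₁ A₂ A₃ : Type u} [AddCommGroup A₁] [Module Rᵐᵒᵖ A₁] [AddCommGroup A₂]
    [Module Rᵐᵒᵖ A₂] [AddCommGroup A₃] [Module Rᵐᵒᵖ A₃] (f : A₁ →ₗ[Rᵐᵒᵖ] A₂) (g : A₂ →ₗ[Rᵐᵒᵖ] A₃)
    (hgf : ∀ a, g (f a) = 0) :
    Function.Exact (Tensor.map R f (LinearMap.id : N →ₗ[R] N))
        (Tensor.map R g (LinearMap.id : N →ₗ[R] N)) ↔
      ∀ φ : A₂ →ₗ[Rᵐᵒᵖ] RDual R N, φ ∘ₗ f = 0 → ∃ ψ : A₃ →ₗ[Rᵐᵒᵖ] RDual R N, ψ ∘ₗ g = φ := by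
  rw [exact_iff_character]
  · constructor
    · intro h φ hφ
      obtain ⟨c, hc⟩ := h (characterEquivRight.symm φ) fun t => by
        refine DFunLike.congr_fun (f := (characterEquivRight.symm φ).comp (Tensor.map R f _))
          (g := 0) (Tensor.hom_ext fun a n => ?_) t
        simpa using DFunLike.congr_fun (DFunLike.congr_fun hφ a) n
      refine ⟨characterEquivRight c, ?_⟩
      ext a n
      simpa using hc (Tensor.tmul a n)
    · intro h c hc
      obtain ⟨ψ, hψ⟩ := h (characterEquivRight c) (by
        ext a n
        simpa using hc (Tensor.tmul a n))
      refine ⟨characterEquivRight.symm ψ, fun b => ?_⟩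
      refine DFunLike.congr_fun (f := (characterEquivRight.symm ψ).comp (Tensor.map R g _))
          (Tensor.hom_ext fun a n => ?_) b
      simpa using DFunLike.congr_fun (DFunLike.congr_fun hψ a) n
  · intro t
    refine DFunLike.congr_fun (f := (Tensor.map R g _).comp (Tensor.map R f _)) (g := 0)
      (Tensor.hom_ext fun a n => ?_) t
    simp [hgf]

/-- Tensoring a complex of left modules with `A` is exact if and only if mapping it to the
character module of `A` is. -/
theorem exact_id_map_iff {N₁ N₂ N₃ : Type u} [AddCommGroup N₁] [Module R N₁] [AddCommGroup N₂]
    [Module R N₂] [AddCommGroup N₃] [Module R N₃] (f : N₁ →ₗ[R] N₂) (g : N₂ →ₗ[R] N₃)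
    (hgf : ∀ a, g (f a) = 0) :
    Function.Exact (Tensor.map R (LinearMap.id : A →ₗ[Rᵐᵒᵖ] A) f)
        (Tensor.map R (LinearMap.id : A →ₗ[Rᵐᵒᵖ] A) g) ↔
      ∀ φ : N₂ →ₗ[R] LDual R A, φ ∘ₗ f = 0 → ∃ ψ : N₃ →ₗ[R] LDual R A, ψ ∘ₗ g = φ := by
  rw [exact_iff_character]
  · constructor
    · intro h φ hφ
      obtain ⟨c, hc⟩ := h (characterEquivLeft.symm φ) fun t => by
        refine DFunLike.congr_fun (f := (characterEquivLeft.symm φ).comp (Tensor.map R _ f))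
          (g := 0) (Tensor.hom_ext fun a n => ?_) t
        simpa using DFunLike.congr_fun (DFunLike.congr_fun hφ n) a
      refine ⟨characterEquivLeft c, ?_⟩
      ext n a
      simpa using hc (Tensor.tmul a n)
    · intro h c hc
      obtain ⟨ψ, hψ⟩ := h (characterEquivLeft c) (by
        ext n a
        simpa using hc (Tensor.tmul a n))
      refine ⟨characterEquivLeft.symm ψ, fun b => ?_⟩
      refine DFunLike.congr_fun (f := (characterEquivLeft.symm ψ).comp (Tensor.map R _ g))
          (Tensor.hom_ext fun a n => ?_) b
      simpa using DFunLike.congr_fun (DFunLike.congr_fun hψ n) a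
  · intro t
    refine DFunLike.congr_fun (f := (Tensor.map R _ g).comp (Tensor.map R _ f)) (g := 0)
      (Tensor.hom_ext fun a n => ?_) t
    simp [hgf]

/-- A left module is flat if and only if its character module is injective. -/
theorem isFlat_iff_injective : IsFlat R N ↔ Module.Injective Rᵐᵒᵖ (RDual R N) := by
  constructor
  · intro h
    refine ⟨fun A B _ _ _ _ f hf g => ?_⟩
    obtain ⟨c, hc⟩ := exists_character_extension _ (h A B f hf) (characterEquivRight.symm g)
    refine ⟨characterEquivRight c, fun a => ?_⟩
    ext n
    simpa using DFunLike.congr_fun hc (Tensor.tmul a n)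
  · intro h A B _ _ _ _ f hf
    refine (injective_iff_map_eq_zero _).2 fun t ht => ?_
    by_contra hn
    obtain ⟨c, hc⟩ := exists_character_ne_zero hn
    obtain ⟨ψ, hψ⟩ := h.out f hf (characterEquivRight c)
    have : (characterEquivRight.symm ψ).comp (Tensor.map R f LinearMap.id) = c :=
      Tensor.hom_ext fun a n => by simp [hψ]
    exact hc (by rw [← this, AddMonoidHom.comp_apply, ht, map_zero])

end Dual

/-- Injectivity in the form used below: φ descends to B / ker g, which embeds in C. -/
theorem exists_factor_of_injective {S : Type u} [Ring S] {B C D : Type u} [AddCommGroup B]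
    [Module S B] [AddCommGroup C] [Module S C] [AddCommGroup D] [Module S D]
    (hD : Module.Injective S D) (g : B →ₗ[S] C) (φ : B →ₗ[S] D) (h : ∀ b, g b = 0 → φ b = 0) :
    ∃ ψ : C →ₗ[S] D, ψ ∘ₗ g = φ := by
  obtain ⟨ψ, hψ⟩ := hD.out ((LinearMap.ker g).liftQ g le_rfl)
    (LinearMap.ker_eq_bot.1 (Submodule.ker_liftQ_eq_bot _ _ _ le_rfl))
    ((LinearMap.ker g).liftQ φ fun b hb => h b hb)
  exact ⟨ψ, LinearMap.ext fun b => hψ (Submodule.Quotient.mk b)⟩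

/-! ### Finitely generated submodules of free modules over a coherent ring -/

section Coherent

variable {S : Type u} [Ring S]

/-- Induction on n through the first coordinate: its image is a finitely generated ideal, hence
finitely presented, so its kernel in K is finitely generated. That kernel embeds in Sⁿ, and an
extension of finitely presented modules is finitely presented. -/
theorem finitePresentation_of_le_pi
    (hS : ∀ I : Ideal S, I.FG → Module.FinitePresentation S I) :
    ∀ (n : ℕ) (K : Submodule S (Fin n → S)), K.FG → Module.FinitePresentation S K
  | 0, K, _ => inferInstance
  | n + 1, K, hK => by
    have : Module.Finite S K := Module.Finite.iff_fg.2 hK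
    let l : K →ₗ[S] S := LinearMap.proj 0 ∘ₗ K.subtype
    have hl : Module.FinitePresentation S (LinearMap.range l) :=
      hS (LinearMap.range l) (Module.Finite.iff_fg.1 inferInstance)
    have hker : (LinearMap.ker l.rangeRestrict).FG :=
      Module.FinitePresentation.fg_ker _ l.surjective_rangeRestrict
    have : Module.Finite S (LinearMap.ker l.rangeRestrict) := Module.Finite.iff_fg.2 hker
    let t : LinearMap.ker l.rangeRestrict →ₗ[S] (Fin n → S) :=
      LinearMap.funLeft S S Fin.succ ∘ₗ K.subtype ∘ₗ (LinearMap.ker l.rangeRestrict).subtype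
    have ht : Function.Injective t := by
      rw [injective_iff_map_eq_zero]
      rintro ⟨⟨x, hxK⟩, hx⟩ h
      have h0 : x 0 = 0 := by
        have := congrArg Subtype.val (LinearMap.mem_ker.1 hx)
        simpa [l] using this
      ext i
      refine Fin.cases h0 (fun j => ?_) i
      exact congrFun h j
    have hrange := finitePresentation_of_le_pi hS n (LinearMap.range t)
      (Module.Finite.iff_fg.1 inferInstance)
    have : Module.FinitePresentation S (LinearMap.ker l.rangeRestrict) :=
      Module.FinitePresentation.of_equiv (M := LinearMap.range t)
        (N := LinearMap.ker l.rangeRestrict) (LinearEquiv.ofInjective t ht).symm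
    exact Module.finitePresentation_of_ker l.rangeRestrict l.surjective_rangeRestrict

/-- One step of a resolution: s carries the syzygy still to be covered, t the next one, which is
finitely generated because the syzygy in s is finitely presented. -/
theorem exists_presentation_step
    (hS : ∀ I : Ideal S, I.FG → Module.FinitePresentation S I)
    (s : (n : ℕ) × {K : Submodule S (Fin n → S) // K.FG}) :
    ∃ (t : (n : ℕ) × {K : Submodule S (Fin n → S) // K.FG}) (d : (Fin t.1 → S) →ₗ[S] (Fin s.1 → S)),
      LinearMap.range d = s.2.1 ∧ LinearMap.ker d = t.2.1 := by
  obtain ⟨n, K, hK⟩ := s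
  obtain ⟨m, π, hπ⟩ := K.fg_iff_exists_fin_linearMap.1 hK
  have := finitePresentation_of_le_pi hS n K hK
  have hr : Module.FinitePresentation S (LinearMap.range π) := by rw [hπ]; exact this
  refine ⟨⟨m, LinearMap.ker π, ?_⟩, π, hπ, rfl⟩
  rw [← LinearMap.ker_rangeRestrict]
  exact Module.FinitePresentation.fg_ker _ π.surjective_rangeRestrict

/-- Over a coherent ring, the quotient of a finite free module by a finitely generated submodule
has a resolution by finite free modules which extends the given presentation. -/
theorem exists_finite_projRes
    (hS : ∀ I : Ideal S, I.FG → Module.FinitePresentation S I) (n : ℕ)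
    (K : Submodule S (Fin n → S)) (hK : K.FG) :
    ∃ P : ProjRes S ((Fin n → S) ⧸ K), (∀ i, Module.Finite S (P.P i)) ∧
      ∃ e : (Fin n → S) ≃ₗ[S] P.P 0, ∀ x, P.ε (e x) = K.mkQ x := by
  choose t d hr hk using exists_presentation_step hS
  let s : ℕ → (n : ℕ) × {K : Submodule S (Fin n → S) // K.FG} := fun i => t^[i] ⟨n, K, hK⟩
  have hs : ∀ i, s (i + 1) = t (s i) := fun i => Function.iterate_succ_apply' t i _
  have key : ∀ i, ∃ δ : (Fin (s (i + 1)).1 → S) →ₗ[S] (Fin (s i).1 → S),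
      LinearMap.range δ = (s i).2.1 ∧ LinearMap.ker δ = (s (i + 1)).2.1 := by
    intro i
    rw [hs]
    exact ⟨d _, hr _, hk _⟩
  choose δ hδr hδk using key
  refine ⟨{ P := fun i => Fin (s i).1 → S
            projective := fun i => inferInstance
            d := δ
            ε := K.mkQ
            exact_d := fun i => LinearMap.exact_iff.2 (by rw [hδk, hδr])
            exact_ε := LinearMap.exact_iff.2 (K.ker_mkQ.trans (hδr 0).symm)
            surjective_ε := K.mkQ_surjective }, fun i => ?_, LinearEquiv.refl S _, fun x => rfl⟩
  change Module.Finite S (Fin (s i).1 → S)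
  infer_instance

end Coherent

variable {R : Type u} [Ring R]

theorem IsRightCoherent.finitePresentation (hR : IsRightCoherent R) (I : Ideal Rᵐᵒᵖ) (hI : I.FG) :
    Module.FinitePresentation Rᵐᵒᵖ I := by
  let e : R ≃ₗ[Rᵐᵒᵖ] Rᵐᵒᵖ :=
    { MulOpposite.opAddEquiv with map_smul' := fun c r => rfl }
  have := hR (Submodule.map e.symm.toLinearMap I) (Submodule.FG.map _ hI)
  exact (e.symm.submoduleMap I).finitePresentation_iff.2 this

/-! ### Flatness of character modules; level modules are flat -/

section Baer

variable {N A : Type u} [AddCommGroup N] [Module R N] [AddCommGroup A] [Module Rᵐᵒᵖ A]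

/-- A form of Baer's criterion for character modules which only involves finitely generated
ideals. -/
theorem injective_RDual_of_relations
    (h : ∀ (k : ℕ) (a : Fin k → Rᵐᵒᵖ) (g : Ideal.span (Set.range a) →ₗ[Rᵐᵒᵖ] RDual R N)
      (x : Fin k → N), ∑ i, (a i).unop • x i = 0 →
        ∑ i, g ⟨a i, Ideal.subset_span ⟨i, rfl⟩⟩ (x i) = 0) :
    Module.Injective Rᵐᵒᵖ (RDual R N) := by
  refine Module.Baer.injective fun I g => ?_
  -- Extending g means finding one character ψ of N with ψ (r x) = g r x, that is, factoring γ
  -- through the multiplication Φ. So γ must kill ker Φ, and an element of ker Φ involves only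
  -- finitely many elements of I.
  let Φ : I ⊗[ℤ] N →+ N := TensorProduct.liftAddHom
    (AddMonoidHom.mk' (fun r => DistribSMul.toAddMonoidHom N (r : Rᵐᵒᵖ).unop)
      fun r s => by ext x; simp [add_smul]) fun k r x => by
        change (k • (r : Rᵐᵒᵖ).unop) • x = (r : Rᵐᵒᵖ).unop • (k • x)
        rw [smul_assoc, smul_comm]
  let γ : I ⊗[ℤ] N →+ QZ := TensorProduct.liftAddHom (g.toAddMonoidHom : I →+ N →+ QZ)
    fun k r x => (congrArg (fun c : RDual R N => c x) (map_zsmul g k r)).trans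
      (map_zsmul (g r) k x).symm
  obtain ⟨ψ, hψ⟩ := exists_character_factor Φ γ fun t ht => by
    obtain ⟨k, a, x, rfl⟩ := TensorProduct.exists_sum_tmul_eq t
    have hle : Ideal.span (Set.range fun i => (a i : Rᵐᵒᵖ)) ≤ I := by
      rw [Ideal.span_le]
      rintro _ ⟨i, rfl⟩
      exact (a i).2
    have := h k (fun i => a i) (g ∘ₗ Submodule.inclusion hle) x (by simpa [Φ] using ht)
    rw [map_sum]
    exact this
  refine ⟨LinearMap.toSpanSingleton Rᵐᵒᵖ (RDual R N) ψ, fun r hr => ?_⟩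
  ext x
  change ψ (Φ ((⟨r, hr⟩ : I) ⊗ₜ x)) = γ ((⟨r, hr⟩ : I) ⊗ₜ x)
  exact hψ _

/-- Over a right coherent ring, the character module of an injective right module is flat. -/
theorem isFlat_LDual (hR : IsRightCoherent R) (hA : Module.Injective Rᵐᵒᵖ A) :
    IsFlat R (LDual R A) := by
  refine isFlat_iff_injective.2 (injective_RDual_of_relations fun k a g x hx => ?_)
  have := hR.finitePresentation (Ideal.span (Set.range a))
    (Submodule.fg_span (Set.finite_range a))
  let π : (Fin k → Rᵐᵒᵖ) →ₗ[Rᵐᵒᵖ] Ideal.span (Set.range a) :=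
    Fintype.linearCombination Rᵐᵒᵖ fun i => ⟨a i, Ideal.subset_span ⟨i, rfl⟩⟩
  have hπ : Function.Surjective π := by
    rintro ⟨b, hb⟩
    obtain ⟨r, rfl⟩ := (Submodule.mem_span_range_iff_exists_fun Rᵐᵒᵖ).1 hb
    exact ⟨r, Subtype.ext (by simp [π, Fintype.linearCombination_apply])⟩
  obtain ⟨m, ρ, hρ⟩ := Submodule.fg_iff_exists_fin_generating_family.1
    (Module.FinitePresentation.fg_ker π hπ)
  -- The aim is the equational criterion: x i = ∑ ρ l i ψ l, with ρ generating the relations among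
  -- the a i. Dually, the character c given by x must factor through the map T given by ρ.
  let T : (Fin k → A) →+ (Fin m → A) :=
    { toFun := fun y l => ∑ i, ρ l i • y i
      map_zero' := by ext; simp
      map_add' := fun y z => by ext; simp [Finset.sum_add_distrib] }
  let c : (Fin k → A) →+ QZ :=
    { toFun := fun y => ∑ i, x i (y i)
      map_zero' := by simp
      map_add' := fun y z => by simp [Finset.sum_add_distrib] }
  obtain ⟨c', hc'⟩ := exists_character_factor T c fun y hy => by
    -- T y = 0 says that a i ↦ y i is a well-defined map from the ideal to A. Injectivity of A
    -- extends it to the ring, so y i = a i y'(1), and the relation among the x i gives c y = 0.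
    obtain ⟨y', hy'⟩ := exists_factor_of_injective hA
      ((Ideal.span (Set.range a)).subtype ∘ₗ π) (Fintype.linearCombination Rᵐᵒᵖ y) fun b hb => by
        have hb : b ∈ Submodule.span Rᵐᵒᵖ (Set.range ρ) := by
          rw [hρ]; exact Subtype.ext hb
        refine (Submodule.span_le (p := LinearMap.ker (Fintype.linearCombination Rᵐᵒᵖ y))).2 ?_ hb
        rintro _ ⟨l, rfl⟩
        exact congrFun hy l
    have hyi : ∀ i, y i = a i • y' 1 := fun i => by
      have := LinearMap.congr_fun hy' (Pi.single i 1)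
      simp only [LinearMap.comp_apply, Fintype.linearCombination_apply_single, π, one_smul,
        Submodule.subtype_apply] at this
      rw [← this, ← map_smul, smul_eq_mul, mul_one]
    calc c y = (∑ i, (a i).unop • x i) (y' 1) := by
          simp [c, LDual.sum_apply, hyi]
      _ = 0 := by rw [hx]; rfl
  let ψ : Fin m → LDual R A := fun l => c'.comp (AddMonoidHom.single (fun _ => A) l)
  have hxψ : ∀ i, x i = ∑ l, (ρ l i).unop • ψ l := fun i => by
    ext z
    have h1 : c (Pi.single i z) = x i z := by
      change ∑ j, x j (Pi.single (M := fun _ => A) i z j) = x i z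
      rw [Finset.sum_eq_single i (fun j _ hj => by rw [Pi.single_eq_of_ne hj, map_zero]) (by simp),
        Pi.single_eq_same]
    rw [← h1, ← hc', LDual.sum_apply]
    have h2 : T (Pi.single i z) = ∑ l, Pi.single l (ρ l i • z) := by
      ext l
      rw [Finset.sum_apply, Finset.sum_eq_single l
        (fun j _ hj => Pi.single_eq_of_ne hj.symm _) (by simp), Pi.single_eq_same]
      change ∑ j, ρ l j • (Pi.single (M := fun _ => A) i z j) = _
      rw [Finset.sum_eq_single i (fun j _ hj => by rw [Pi.single_eq_of_ne hj, smul_zero])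
        (by simp), Pi.single_eq_same]
    rw [h2, map_sum]
    rfl
  have hrel : ∀ l, ∑ i, ρ l i • (⟨a i, Ideal.subset_span ⟨i, rfl⟩⟩ : Ideal.span (Set.range a)) = 0 :=
    fun l => by
      have : ρ l ∈ LinearMap.ker π := hρ ▸ Submodule.subset_span ⟨l, rfl⟩
      exact this
  calc ∑ i, g ⟨a i, Ideal.subset_span ⟨i, rfl⟩⟩ (x i)
      = ∑ i, ∑ l, (ρ l i • g ⟨a i, Ideal.subset_span ⟨i, rfl⟩⟩) (ψ l) := by
        refine Finset.sum_congr rfl fun i _ => ?_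
        rw [hxψ i, map_sum]
        rfl
    _ = ∑ l, g (∑ i, ρ l i • ⟨a i, Ideal.subset_span ⟨i, rfl⟩⟩) (ψ l) := by
        rw [Finset.sum_comm]
        refine Finset.sum_congr rfl fun l _ => ?_
        rw [map_sum, RDual.sum_apply]
        exact Finset.sum_congr rfl fun i _ => by rw [map_smul]
    _ = 0 := by simp only [hrel, map_zero, RDual.zero_apply, Finset.sum_const_zero]

/-- Over a right coherent ring, maps from finitely generated submodules of finite free right
modules to the character module of a level module extend. -/
theorem IsLevel.exists_extension (hR : IsRightCoherent R) (hN : IsLevel R N) (n : ℕ)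
    (K : Submodule Rᵐᵒᵖ (Fin n → Rᵐᵒᵖ)) (hK : K.FG) (g : K →ₗ[Rᵐᵒᵖ] RDual R N) :
    ∃ h : (Fin n → Rᵐᵒᵖ) →ₗ[Rᵐᵒᵖ] RDual R N, ∀ x : K, h x = g x := by
  obtain ⟨P, hP, e, he⟩ := exists_finite_projRes hR.finitePresentation n K hK
  have hmem : ∀ x, e.symm x ∈ K ↔ P.ε x = 0 := fun x => by
    obtain ⟨y, rfl⟩ := e.surjective x
    simp [he]
  let p : P.P 1 →ₗ[Rᵐᵒᵖ] K := LinearMap.codRestrict K (e.symm.toLinearMap ∘ₗ P.d 0) fun x =>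
    (hmem _).2 (P.exact_ε.apply_apply_eq_zero x)
  -- Vanishing of Tor₁ says that a map P₁ → N⁺ killing the image of P₂ factors through `P.d 0`; here
  -- K is that image of P₁ in P₀.
  obtain ⟨ψ, hψ⟩ := (exact_map_id_iff (P.d 1) (P.d 0)
    (P.exact_d 0).apply_apply_eq_zero).1 (hN _ ⟨P, hP⟩ P) (g ∘ₗ p) (by
      ext1 x
      have : p (P.d 1 x) = 0 := Subtype.ext (by
        change e.symm (P.d 0 (P.d 1 x)) = 0
        rw [(P.exact_d 0).apply_apply_eq_zero, map_zero])
      simp [this])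
  refine ⟨ψ ∘ₗ e.toLinearMap, fun x => ?_⟩
  obtain ⟨z, hz⟩ := (P.exact_ε (e x)).1 ((hmem _).1 (by simp))
  have hpz : p z = x := Subtype.ext (by simp [p, hz])
  have := LinearMap.congr_fun hψ z
  simpa [hz, hpz] using this

/-- For level N, a map g from a finitely generated ideal to N⁺ extends to the ring, so g(a i) = a i
h(1) and any relation ∑ a i x i = 0 is respected. Conversely N⁺ is injective for flat N, so Hom(-,
N⁺) keeps every resolution exact. -/
theorem isLevel_iff_isFlat (hR : IsRightCoherent R) : IsLevel R N ↔ IsFlat R N := by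
  constructor
  · intro hN
    refine isFlat_iff_injective.2 (injective_RDual_of_relations fun k a g x hx => ?_)
    let e := LinearEquiv.funUnique (Fin 1) Rᵐᵒᵖ Rᵐᵒᵖ
    let I := Ideal.span (Set.range a)
    obtain ⟨h, hh⟩ := hN.exists_extension hR 1 (Submodule.map e.symm.toLinearMap I)
      (Submodule.FG.map _ (Submodule.fg_span (Set.finite_range a)))
      (g ∘ₗ (e.symm.submoduleMap I).symm.toLinearMap)
    have hg : ∀ i, g ⟨a i, Ideal.subset_span ⟨i, rfl⟩⟩ = a i • h (e.symm 1) := fun i => by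
      have := hh (e.symm.submoduleMap I ⟨a i, Ideal.subset_span ⟨i, rfl⟩⟩)
      rw [LinearMap.comp_apply, LinearEquiv.coe_coe, LinearEquiv.symm_apply_apply] at this
      rw [← this, ← map_smul, ← map_smul]
      simp
    simp only [hg, RDual.smul_apply, ← map_sum, hx, map_zero]
  · intro hN M _ _ _ P
    refine (exact_map_id_iff _ _ (P.exact_d 0).apply_apply_eq_zero).2 fun φ hφ => ?_
    refine exists_factor_of_injective (isFlat_iff_injective.1 hN) _ _ fun b hb => ?_
    obtain ⟨x, rfl⟩ := (P.exact_d 0 b).1 hb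
    exact LinearMap.congr_fun hφ x

end Baer

/-! ### Null-homotopy of maps from projective complexes to pure exact complexes -/

section NullHomotopy

variable {R : Type u} [Ring R]

/-- The kernel of `δ` is a pure submodule, in the form of an extension property for maps between
finite free modules. -/
def HasPureKernel {Y Y' : Type u} [AddCommGroup Y] [Module R Y] [AddCommGroup Y'] [Module R Y']
    (δ : Y →ₗ[R] Y') : Prop :=
  ∀ (ι κ : Type u) [Finite ι] [Finite κ] (φ : (ι →₀ R) →ₗ[R] (κ →₀ R)) (v : (κ →₀ R) →ₗ[R] Y),
    δ ∘ₗ v ∘ₗ φ = 0 → ∃ w : (κ →₀ R) →ₗ[R] Y, δ ∘ₗ w = 0 ∧ w ∘ₗ φ = v ∘ₗ φ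

theorem hasPureKernel_of_injective {Y Y' : Type u} [AddCommGroup Y] [Module R Y] [AddCommGroup Y']
    [Module R Y'] (δ : Y →ₗ[R] Y') (h : Function.Injective δ) : HasPureKernel δ := by
  intro ι κ _ _ φ v hv
  refine ⟨0, by simp, LinearMap.ext fun x => h ?_⟩
  simpa using (LinearMap.congr_fun hv x).symm

theorem exists_lift_of_exact {V A B C : Type u} [AddCommGroup V] [Module R V]
    [Module.Projective R V] [AddCommGroup A] [Module R A] [AddCommGroup B] [Module R B]
    [AddCommGroup C] [Module R C] {f : A →ₗ[R] B} {g : B →ₗ[R] C} (hfg : Function.Exact f g)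
    (φ : V →ₗ[R] B) (hφ : g ∘ₗ φ = 0) : ∃ ψ : V →ₗ[R] A, f ∘ₗ ψ = φ := by
  obtain ⟨ψ, hψ⟩ := Module.projective_lifting_property f.rangeRestrict
    (φ.codRestrict (LinearMap.range f) fun x => (hfg _).1 (LinearMap.congr_fun hφ x))
    f.surjective_rangeRestrict
  exact ⟨ψ, LinearMap.ext fun x => congrArg Subtype.val (LinearMap.congr_fun hψ x)⟩

variable {Y : ℕ → Type u} [∀ j, AddCommGroup (Y j)] [∀ j, Module R (Y j)]
  (δ : ∀ j, Y j →ₗ[R] Y (j + 1))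

/-- The map `δ s + s d` attached to a family `s` of maps of degree `-1`. -/
def homotopyMap {X : ℕ → Type u} [∀ j, AddCommGroup (X j)] [∀ j, Module R (X j)]
    (d : ∀ j, X j →ₗ[R] X (j + 1)) (s : ∀ j, X (j + 1) →ₗ[R] Y j) : ∀ j, X j →ₗ[R] Y j
  -- The target complex starts in degree 0, so there is no δ s term here. This is what later turns a
  -- homotopy into an extension of f 0 along d 0.
  | 0 => s 0 ∘ₗ d 0
  | j + 1 => δ j ∘ₗ s j + s (j + 1) ∘ₗ d (j + 1)

/-- Recursion on the degree with the invariant (f (m+1) − δ s) d = 0. Purity replaces f (m+2) by a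
map into ker δ agreeing with it on the image of d; lifting that map gives the next s'. -/
theorem exists_homotopy_of_finite_free (hδ : ∀ j, Function.Exact (δ j) (δ (j + 1)))
    (h0 : Function.Injective (δ 0)) (hp : ∀ j, HasPureKernel (δ j)) {ι : ℕ → Type u}
    [∀ j, Finite (ι j)] (d : ∀ j, (ι j →₀ R) →ₗ[R] (ι (j + 1) →₀ R))
    (hd : ∀ j, d (j + 1) ∘ₗ d j = 0) (f : ∀ j, (ι j →₀ R) →ₗ[R] Y j)
    (hf : ∀ j, f (j + 1) ∘ₗ d j = δ j ∘ₗ f j) :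
    ∃ s : ∀ j, (ι (j + 1) →₀ R) →ₗ[R] Y j, ∀ j, f j = homotopyMap δ d s j := by
  have hδδ : ∀ j x, δ (j + 1) (δ j x) = 0 := fun j => (hδ j).apply_apply_eq_zero
  have hfx : ∀ j x, f (j + 1) (d j x) = δ j (f j x) := fun j => LinearMap.congr_fun (hf j)
  have hstart : ∃ s : (ι 1 →₀ R) →ₗ[R] Y 0, (f 1 - δ 0 ∘ₗ s) ∘ₗ d 0 = 0 ∧ f 0 = s ∘ₗ d 0 := by
    obtain ⟨w, hw, hwd⟩ := hp 1 _ _ (d 0) (f 1) (by rw [hf]; refine LinearMap.ext fun x => ?_; simp [hδδ])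
    obtain ⟨s, rfl⟩ := exists_lift_of_exact (hδ 0) w hw
    have hs : f 0 = s ∘ₗ d 0 := by
      refine LinearMap.ext fun x => ?_
      apply h0
      rw [← hfx]
      exact (LinearMap.congr_fun hwd x).symm
    refine ⟨s, ?_, hs⟩
    refine LinearMap.ext fun x => ?_
    have := LinearMap.congr_fun hs x
    simp only [LinearMap.comp_apply] at this
    simp [hfx, this]
  have hstep : ∀ m (s : (ι (m + 1) →₀ R) →ₗ[R] Y m), (f (m + 1) - δ m ∘ₗ s) ∘ₗ d m = 0 →
      ∃ (c : (ι (m + 1) →₀ R) →ₗ[R] Y m) (s' : (ι (m + 2) →₀ R) →ₗ[R] Y (m + 1)), c ∘ₗ d m = 0 ∧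
        f (m + 1) = δ m ∘ₗ (s + c) + s' ∘ₗ d (m + 1) ∧
          (f (m + 2) - δ (m + 1) ∘ₗ s') ∘ₗ d (m + 1) = 0 := by
    intro m s hs
    obtain ⟨w, hw, hwd⟩ := hp (m + 2) _ _ (d (m + 1)) (f (m + 2)) (by rw [hf]; refine LinearMap.ext fun x => ?_; simp [hδδ])
    obtain ⟨s', rfl⟩ := exists_lift_of_exact (hδ (m + 1)) w hw
    have hs' : ∀ x, δ (m + 1) (s' (d (m + 1) x)) = δ (m + 1) (f (m + 1) x) := fun x => by
      rw [← hfx]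
      exact LinearMap.congr_fun hwd x
    obtain ⟨c₀, hc₀⟩ := exists_lift_of_exact (hδ m)
      (f (m + 1) - δ m ∘ₗ s - s' ∘ₗ d (m + 1)) (by refine LinearMap.ext fun x => ?_; simp [hδδ, hs'])
    have hc₀x : ∀ x, δ m (c₀ x) = f (m + 1) x - δ m (s x) - s' (d (m + 1) x) :=
      LinearMap.congr_fun hc₀
    -- The error in degree m+1 is δ c₀. A second use of purity subtracts from c₀ a map into ker δ so
    -- that the correction kills the image of d; the equation already obtained in degree m then
    -- survives.
    obtain ⟨w, hw, hwd'⟩ := hp m _ _ (d m) c₀ (by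
      refine LinearMap.ext fun x => ?_
      have h1 := LinearMap.congr_fun hs x
      have h2 := LinearMap.congr_fun (hd m) x
      simp only [LinearMap.comp_apply, LinearMap.sub_apply, LinearMap.zero_apply] at h1 h2
      simp only [LinearMap.comp_apply, hc₀x, h1, h2, map_zero, sub_zero, LinearMap.zero_apply])
    refine ⟨c₀ - w, s', by rw [LinearMap.sub_comp, hwd', sub_self], ?_, ?_⟩
    · refine LinearMap.ext fun x => ?_
      have := LinearMap.congr_fun hw x
      simp only [LinearMap.comp_apply, LinearMap.zero_apply] at this
      simp [this, hc₀x]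
      abel
    · refine LinearMap.ext fun x => ?_
      simp [hs', hfx]
  choose c s' hcd hfs hs' using hstep
  obtain ⟨s₀, hs₀, hfs₀⟩ := hstart
  let p : ∀ m, {s : (ι (m + 1) →₀ R) →ₗ[R] Y m // (f (m + 1) - δ m ∘ₗ s) ∘ₗ d m = 0} :=
    fun m => Nat.rec ⟨s₀, hs₀⟩ (fun m s => ⟨s' m s.1 s.2, hs' m s.1 s.2⟩) m
  refine ⟨fun m => (p m).1 + c m (p m).1 (p m).2, fun j => ?_⟩
  match j with
  | 0 =>
    change f 0 = ((p 0).1 + c 0 (p 0).1 (p 0).2) ∘ₗ d 0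
    rw [LinearMap.add_comp, hcd, add_zero]
    exact hfs₀
  | m + 1 =>
    change f (m + 1) = δ m ∘ₗ ((p m).1 + c m (p m).1 (p m).2) +
      ((p (m + 1)).1 + c (m + 1) (p (m + 1)).1 (p (m + 1)).2) ∘ₗ d (m + 1)
    rw [LinearMap.add_comp, hcd, add_zero]
    exact hfs m (p m).1 (p m).2

/-! ### From degreewise finite free complexes to free complexes, by Zorn's lemma -/

section Free

variable {B : ℕ → Type u} (d : ∀ j, (B j →₀ R) →ₗ[R] (B (j + 1) →₀ R))
  (f : ∀ j, (B j →₀ R) →ₗ[R] Y j)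

theorem eqOn_supported {ι M : Type*} [AddCommGroup M] [Module R M] {S : Set ι}
    {f g : (ι →₀ R) →ₗ[R] M} (h : ∀ b ∈ S, f (Finsupp.single b 1) = g (Finsupp.single b 1))
    {x : ι →₀ R} (hx : x ∈ Finsupp.supported R R S) : f x = g x := by
  rw [Finsupp.supported_eq_span_single] at hx
  refine LinearMap.eqOn_span ?_ hx
  rintro _ ⟨b, hb, rfl⟩
  exact h b hb

/-- A family of subsets of the bases which spans a subcomplex. -/
def IsClosedFamily (S : ∀ j, Set (B j)) : Prop :=
  ∀ j, ∀ b ∈ S j, d j (Finsupp.single b 1) ∈ Finsupp.supported R R (S (j + 1))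

variable {d} in
theorem IsClosedFamily.map_mem {S : ∀ j, Set (B j)} (hS : IsClosedFamily d S) {j : ℕ}
    {x : B j →₀ R} (hx : x ∈ Finsupp.supported R R (S j)) :
    d j x ∈ Finsupp.supported R R (S (j + 1)) := by
  rw [Finsupp.supported_eq_span_single] at hx
  have : Submodule.span R ((fun i => Finsupp.single i (1 : R)) '' S j) ≤
      (Finsupp.supported R R (S (j + 1))).comap (d j) := by
    rw [Submodule.span_le]
    rintro _ ⟨b, hb, rfl⟩
    exact hS j b hb
  exact this hx

variable {d} in
theorem homotopyMap_congr {S : ∀ j, Set (B j)} (hS : IsClosedFamily d S)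
    {s s' : ∀ j, (B (j + 1) →₀ R) →ₗ[R] Y j}
    (h : ∀ j, ∀ b ∈ S (j + 1), s j (Finsupp.single b 1) = s' j (Finsupp.single b 1)) :
    ∀ (j : ℕ) (x : B j →₀ R), x ∈ Finsupp.supported R R (S j) →
      homotopyMap δ d s j x = homotopyMap δ d s' j x
  | 0, x, hx => eqOn_supported (h 0) (hS.map_mem hx)
  | j + 1, x, hx => by
    change δ j (s j x) + s (j + 1) (d (j + 1) x) = δ j (s' j x) + s' (j + 1) (d (j + 1) x)
    rw [eqOn_supported (h j) hx, eqOn_supported (h (j + 1)) (hS.map_mem hx)]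

/-- A null-homotopy of the restriction of `f` to a subcomplex spanned by basis elements. -/
structure PartialHomotopy where
  S : ∀ j, Set (B j)
  closed : IsClosedFamily d S
  s : ∀ j, (B (j + 1) →₀ R) →ₗ[R] Y j
  eq : ∀ j, ∀ x ∈ Finsupp.supported R R (S j), f j x = homotopyMap δ d s j x

/-- Only the values of s on the chosen basis elements count, so this order is not antisymmetric. -/
instance : Preorder (PartialHomotopy δ d f) where
  le a b := (∀ j, a.S j ⊆ b.S j) ∧
    ∀ j, ∀ x ∈ a.S (j + 1), a.s j (Finsupp.single x 1) = b.s j (Finsupp.single x 1)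
  le_refl a := ⟨fun j => subset_rfl, fun j x _ => rfl⟩
  le_trans a b c hab hbc := ⟨fun j => (hab.1 j).trans (hbc.1 j), fun j x hx =>
    (hab.2 j x hx).trans (hbc.2 j x (hab.1 _ hx))⟩

variable {δ d f} in
theorem PartialHomotopy.bddAbove_of_isChain (C : Set (PartialHomotopy δ d f))
    (hC : IsChain (· ≤ ·) C) : BddAbove C := by
  classical
  let s : ∀ j, (B (j + 1) →₀ R) →ₗ[R] Y j := fun j => Finsupp.linearCombination R fun x =>
    -- Members of a chain agree on common basis elements, so any choice will do; off the union the
    -- value 0 is arbitrary.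
    if h : ∃ a ∈ C, x ∈ a.S (j + 1) then h.choose.s j (Finsupp.single x 1) else 0
  have hs : ∀ a ∈ C, ∀ j, ∀ x ∈ a.S (j + 1), s j (Finsupp.single x 1) = a.s j (Finsupp.single x 1) := by
    intro a ha j x hx
    have h : ∃ a ∈ C, x ∈ a.S (j + 1) := ⟨a, ha, hx⟩
    simp only [s, Finsupp.linearCombination_single, one_smul, dif_pos h]
    rcases hC.total h.choose_spec.1 ha with hle | hle
    · exact hle.2 j x h.choose_spec.2
    · exact (hle.2 j x hx).symm
  refine ⟨⟨fun j => ⋃ a ∈ C, a.S j, ?_, s, ?_⟩, fun a ha => ⟨fun j =>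
    Set.subset_biUnion_of_mem (u := fun a : PartialHomotopy δ d f => a.S j) ha, fun j x hx =>
      (hs a ha j x hx).symm⟩⟩
  · intro j b hb
    obtain ⟨a, ha, hba⟩ := Set.mem_iUnion₂.1 hb
    exact Finsupp.supported_mono (Set.subset_biUnion_of_mem
      (u := fun a : PartialHomotopy δ d f => a.S (j + 1)) ha) (a.closed j b hba)
  · intro j x hx
    refine eqOn_supported (fun b hb => ?_) hx
    obtain ⟨a, ha, hba⟩ := Set.mem_iUnion₂.1 hb
    have hmem := Finsupp.single_mem_supported R (1 : R) hba
    rw [a.eq j _ hmem]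
    exact homotopyMap_congr δ a.closed (fun i x hx => (hs a ha i x hx).symm) j _ hmem

/-- The differential raises the degree and each basis element has a boundary of finite support, so
closing up {b} stays finite in every degree, although infinitely many degrees may occur. -/
theorem exists_finite_isClosedFamily (n : ℕ) (b : B n) :
    ∃ T : ∀ j, Set (B j), (∀ j, (T j).Finite) ∧ b ∈ T n ∧ IsClosedFamily d T := by
  let I : ∀ j, Set (B j) := fun j => {x | (⟨j, x⟩ : Σ j, B j) = ⟨n, b⟩}
  have hI : ∀ j, (I j).Finite := fun j => Set.Subsingleton.finite fun x hx y hy => by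
    have : (⟨j, x⟩ : Σ j, B j) = ⟨j, y⟩ := hx.trans hy.symm
    simpa using this
  let T : ∀ j, Set (B j) := fun j => Nat.rec (I 0)
    (fun j Tj => I (j + 1) ∪ ⋃ x ∈ Tj, ((d j (Finsupp.single x 1)).support : Set (B (j + 1)))) j
  have hT : ∀ j, T (j + 1) =
      I (j + 1) ∪ ⋃ x ∈ T j, ((d j (Finsupp.single x 1)).support : Set (B (j + 1))) :=
    fun j => rfl
  refine ⟨T, fun j => ?_, ?_, fun j x hx => ?_⟩
  · induction j with
    | zero => exact hI 0
    | succ j ih =>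
      rw [hT]
      exact (hI _).union (ih.biUnion fun x _ => Finset.finite_toSet _)
  · cases n with
    | zero => exact rfl
    | succ n => exact Or.inl rfl
  · rw [Finsupp.mem_supported, hT]
    exact (Set.subset_biUnion_of_mem (u := fun x =>
      ((d j (Finsupp.single x 1)).support : Set (B (j + 1)))) hx).trans Set.subset_union_right

variable {δ d f}

/-- Modulo the subcomplex on S, the complex on S ∪ U is finite free in each degree, with basis U.
Subtracting the known homotopy from f gives a chain map g that vanishes on S, hence descends to this
quotient, where the finite case applies. -/
theorem PartialHomotopy.exists_extension (hδ : ∀ j, Function.Exact (δ j) (δ (j + 1)))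
    (h0 : Function.Injective (δ 0)) (hp : ∀ j, HasPureKernel (δ j))
    (hd : ∀ j, d (j + 1) ∘ₗ d j = 0) (hf : ∀ j, f (j + 1) ∘ₗ d j = δ j ∘ₗ f j)
    (a : PartialHomotopy δ d f) (U : ∀ j, Set (B j)) (hU : ∀ j, (U j).Finite)
    (hdisj : ∀ j, Disjoint (a.S j) (U j)) (hcl : IsClosedFamily d fun j => a.S j ∪ U j) :
    ∃ a' : PartialHomotopy δ d f, a ≤ a' ∧ ∀ j, U j ⊆ a'.S j := by
  classical
  have hδδ : ∀ j x, δ (j + 1) (δ j x) = 0 := fun j => (hδ j).apply_apply_eq_zero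
  have hdd : ∀ j x, d (j + 1) (d j x) = 0 := fun j => LinearMap.congr_fun (hd j)
  have hfx : ∀ j x, f (j + 1) (d j x) = δ j (f j x) := fun j => LinearMap.congr_fun (hf j)
  have : ∀ j, Finite (U j) := fun j => (hU j).to_subtype
  let p : ∀ j, (B j →₀ R) →ₗ[R] (U j →₀ R) := fun j => Finsupp.lsubtypeDomain (U j)
  let q : ∀ j, (U j →₀ R) →ₗ[R] (B j →₀ R) := fun j => Finsupp.lmapDomain R R Subtype.val
  have hpS : ∀ j, ∀ x ∈ Finsupp.supported R R (a.S j), p j x = 0 := fun j x hx => by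
    refine eqOn_supported (g := 0) (fun b hb => ?_) hx
    ext ⟨c, hc⟩
    have : b ≠ c := fun h => Set.disjoint_left.1 (hdisj j) hb (h ▸ hc)
    change Finsupp.single b (1 : R) c = 0
    rw [Finsupp.single_apply, if_neg this]
  have hpU : ∀ j (b : U j), p j (Finsupp.single b.1 1) = Finsupp.single b 1 := fun j b => by
    ext c
    change Finsupp.single b.1 (1 : R) c.1 = Finsupp.single b 1 c
    simp [Finsupp.single_apply, Subtype.ext_iff]
  have hq : ∀ j v, q j v ∈ Finsupp.supported R R (a.S j ∪ U j) := fun j v => by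
    rw [Finsupp.mem_supported]
    refine (Finset.coe_subset.2 Finsupp.mapDomain_support).trans ?_
    intro b hb
    obtain ⟨c, -, rfl⟩ := Finset.mem_image.1 (Finset.mem_coe.1 hb)
    exact Or.inr c.2
  have hqp : ∀ j, ∀ x ∈ Finsupp.supported R R (a.S j ∪ U j),
      x - q j (p j x) ∈ Finsupp.supported R R (a.S j) := fun j x hx => by
    rw [Finsupp.supported_eq_span_single] at hx
    have : Submodule.span R ((fun i => Finsupp.single i (1 : R)) '' (a.S j ∪ U j)) ≤
        (Finsupp.supported R R (a.S j)).comap (LinearMap.id - q j ∘ₗ p j) := by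
      rw [Submodule.span_le]
      rintro _ ⟨b, hb | hb, rfl⟩
      · have hm := Finsupp.single_mem_supported R (1 : R) hb
        simpa [hpS j _ hm] using hm
      · have := hpU j ⟨b, hb⟩
        simp only at this
        simp [this, q]
    exact this hx
  let g : ∀ j, (B j →₀ R) →ₗ[R] Y j := fun j => f j - homotopyMap δ d a.s j
  have hg : ∀ j x, g (j + 1) (d j x) = δ j (g j x) := fun j x => by
    cases j with
    | zero => simp [g, homotopyMap, hfx, hdd]
    | succ j => simp [g, homotopyMap, hfx, hdd, hδδ]
  have hgS : ∀ j, ∀ x ∈ Finsupp.supported R R (a.S j), g j x = 0 := fun j x hx =>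
    sub_eq_zero.2 (a.eq j x hx)
  have hgqp : ∀ j, ∀ x ∈ Finsupp.supported R R (a.S j ∪ U j), g j (q j (p j x)) = g j x :=
    fun j x hx => by
      have := hgS j _ (hqp j x hx)
      rw [map_sub, sub_eq_zero] at this
      exact this.symm
  let dV : ∀ j, (U j →₀ R) →ₗ[R] (U (j + 1) →₀ R) := fun j => p (j + 1) ∘ₗ d j ∘ₗ q j
  have hdV : ∀ j, ∀ x ∈ Finsupp.supported R R (a.S j ∪ U j), dV j (p j x) = p (j + 1) (d j x) :=
    fun j x hx => by
      have := hpS (j + 1) _ (a.closed.map_mem (hqp j x hx))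
      rw [map_sub, map_sub, sub_eq_zero] at this
      exact this.symm
  obtain ⟨sV, hsV⟩ := exists_homotopy_of_finite_free δ hδ h0 hp dV
    (fun j => LinearMap.ext fun v => by
      change dV (j + 1) (p (j + 1) (d j (q j v))) = 0
      rw [hdV _ _ (hcl.map_mem (hq j v)), hdd, map_zero])
    (fun j => g j ∘ₗ q j)
    (fun j => LinearMap.ext fun v => by
      change g (j + 1) (q (j + 1) (p (j + 1) (d j (q j v)))) = δ j (g j (q j v))
      rw [hgqp _ _ (hcl.map_mem (hq j v)), hg])
  have hmain : ∀ j, ∀ x ∈ Finsupp.supported R R (a.S j ∪ U j),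
      g j x = homotopyMap δ d (fun j => sV j ∘ₗ p (j + 1)) j x := fun j x hx => by
    rw [← hgqp j x hx]
    refine (LinearMap.congr_fun (hsV j) (p j x)).trans ?_
    cases j with
    | zero => simp [homotopyMap, hdV 0 x hx]
    | succ j => simp [homotopyMap, hdV (j + 1) x hx]
  refine ⟨⟨fun j => a.S j ∪ U j, hcl, fun j => a.s j + sV j ∘ₗ p (j + 1), fun j x hx => ?_⟩,
    ⟨fun j => Set.subset_union_left, fun j x hx => ?_⟩, fun j => Set.subset_union_right⟩
  · have h1 : f j x = homotopyMap δ d a.s j x + g j x := by simp [g]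
    rw [h1, hmain j x hx]
    cases j with
    | zero => simp [homotopyMap]
    | succ j =>
      simp only [homotopyMap, LinearMap.add_apply, LinearMap.comp_apply, map_add]
      abel
  · simp [hpS (j + 1) _ (Finsupp.single_mem_supported R (1 : R) hx)]

theorem exists_homotopy_of_free (hδ : ∀ j, Function.Exact (δ j) (δ (j + 1)))
    (h0 : Function.Injective (δ 0)) (hp : ∀ j, HasPureKernel (δ j))
    (hd : ∀ j, d (j + 1) ∘ₗ d j = 0) (hf : ∀ j, f (j + 1) ∘ₗ d j = δ j ∘ₗ f j) :
    ∃ s : ∀ j, (B (j + 1) →₀ R) →ₗ[R] Y j, ∀ j, f j = homotopyMap δ d s j := by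
  obtain ⟨a, ha⟩ := zorn_le (α := PartialHomotopy δ d f) PartialHomotopy.bddAbove_of_isChain
  have hS : ∀ j b, b ∈ a.S j := fun n b => by
    obtain ⟨T, hTf, hbT, hT⟩ := exists_finite_isClosedFamily d n b
    obtain ⟨a', haa', hU⟩ := a.exists_extension hδ h0 hp hd hf (fun j => T j \ a.S j)
      (fun j => (hTf j).sdiff) (fun j => Set.disjoint_sdiff_right) (by
        intro j x hx
        simp only [Set.union_sdiff_self] at hx ⊢
        rcases hx with hx | hx
        · exact Finsupp.supported_mono Set.subset_union_left (a.closed j x hx)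
        · exact Finsupp.supported_mono Set.subset_union_right (hT j x hx))
    by_contra hb
    exact hb ((ha haa').1 n (hU n ⟨hbT, hb⟩))
  exact ⟨a.s, fun j => LinearMap.ext fun x => a.eq j x fun b _ => hS j b⟩

end Free

/-- Every chain map from a complex of projective modules to a pure exact complex, both indexed by
the natural numbers, is null-homotopic. -/
theorem exists_homotopy_of_projective (hδ : ∀ j, Function.Exact (δ j) (δ (j + 1)))
    (h0 : Function.Injective (δ 0)) (hp : ∀ j, HasPureKernel (δ j)) {X : ℕ → Type u}
    [∀ j, AddCommGroup (X j)] [∀ j, Module R (X j)] (hX : ∀ j, Module.Projective R (X j))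
    (d : ∀ j, X j →ₗ[R] X (j + 1)) (hd : ∀ j, d (j + 1) ∘ₗ d j = 0) (f : ∀ j, X j →ₗ[R] Y j)
    (hf : ∀ j, f (j + 1) ∘ₗ d j = δ j ∘ₗ f j) :
    ∃ s : ∀ j, X (j + 1) →ₗ[R] Y j, ∀ j, f j = homotopyMap δ d s j := by
  choose i hi using fun j => Module.projective_def.1 (hX j)
  let π : ∀ j, (X j →₀ R) →ₗ[R] X j := fun j => Finsupp.linearCombination R id
  have hπ : ∀ j x, π j (i j x) = x := hi
  -- As π i = id, the maps i d π form a complex of free modules and f π is a chain map on it;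
  -- composing its homotopy with i gives one for f.
  obtain ⟨s, hs⟩ := exists_homotopy_of_free (δ := δ) (d := fun j => i (j + 1) ∘ₗ d j ∘ₗ π j)
    (f := fun j => f j ∘ₗ π j) hδ h0 hp
    (fun j => LinearMap.ext fun x => by
      have := LinearMap.congr_fun (hd j) (π j x)
      simp only [LinearMap.comp_apply, LinearMap.zero_apply] at this
      simp [hπ, this])
    (fun j => LinearMap.ext fun x => by
      have := LinearMap.congr_fun (hf j) (π j x)
      simp only [LinearMap.comp_apply] at this
      simp [hπ, this])
  refine ⟨fun j => s j ∘ₗ i (j + 1), fun j => LinearMap.ext fun x => ?_⟩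
  have := LinearMap.congr_fun (hs j) (i j x)
  cases j with
  | zero => simpa [homotopyMap, hπ] using this
  | succ j => simpa [homotopyMap, hπ] using this

end NullHomotopy

variable {R : Type u} [Ring R]

/-! ### The double character module -/

section DoubleDual

variable (N : Type u) [AddCommGroup N] [Module R N]

/-- The evaluation map from a left module to its double character module. -/
def evalMap : N →ₗ[R] LDual R (RDual R N) where
  toFun x := AddMonoidHom.mk' (fun c : RDual R N => c x) fun _ _ => rfl
  map_add' x y := by
    ext c
    exact map_add c x y
  map_smul' r x := rfl

variable {N}

@[simp] theorem evalMap_apply (x : N) (c : RDual R N) : evalMap (R := R) N x c = c x := rfl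

variable (N) in
theorem evalMap_injective : Function.Injective (evalMap (R := R) N) := by
  refine (injective_iff_map_eq_zero _).2 fun x hx => ?_
  by_contra hn
  obtain ⟨c, hc⟩ := exists_character_ne_zero hn
  exact hc (DFunLike.congr_fun hx (c : RDual R N))

/-- A left module is pure in its double character module. -/
theorem hasPureKernel_of_exact_evalMap {Y : Type u} [AddCommGroup Y] [Module R Y]
    (δ : LDual R (RDual R N) →ₗ[R] Y) (hδ : Function.Exact (evalMap (R := R) N) δ) :
    HasPureKernel δ := by
  classical
  intro ι κ _ _ φ v hv
  have := Fintype.ofFinite ι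
  have := Fintype.ofFinite κ
  have hu : ∀ k, ∃ x, evalMap N x = v (φ (Finsupp.single k 1)) := fun k =>
    (hδ _).1 (LinearMap.congr_fun hv (Finsupp.single k 1))
  choose u hu using hu
  let T : (κ → N) →+ (ι → N) :=
    { toFun := fun y k => ∑ l, φ (Finsupp.single k 1) l • y l
      map_zero' := by ext; simp
      map_add' := fun y z => by ext; simp [Finset.sum_add_distrib] }
  -- The system ∑ φ l y l = u, solved in N⁺⁺ by v, must be solved in N. A character of Nⁱ separating
  -- u from the solvable right-hand sides is a tuple χ in N⁺ annihilated by the coefficients;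
  -- evaluating the solution v at χ shows that the character also vanishes at u.
  have hmem : u ∈ T.range := by
    by_contra hn
    obtain ⟨c, hcT, hcu⟩ := exists_character_separating T.range hn
    let χ : ι → RDual R N := fun k => c.comp (AddMonoidHom.single (fun _ => N) k)
    have hc : ∀ y, c y = ∑ k, χ k (y k) := fun y => by
      conv_lhs => rw [← Finset.univ_sum_single y, map_sum]
      rfl
    have hχ : ∀ l, ∑ k, MulOpposite.op (φ (Finsupp.single k 1) l) • χ k = 0 := fun l => by
      ext z
      rw [RDual.sum_apply]
      have := hcT _ ⟨Pi.single l z, rfl⟩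
      rw [hc] at this
      refine Eq.trans (Finset.sum_congr rfl fun k _ => ?_) this
      change χ k (φ (Finsupp.single k 1) l • z) = χ k (∑ j, φ (Finsupp.single k 1) j •
        Pi.single (M := fun _ => N) l z j)
      rw [Finset.sum_eq_single l (fun j _ hj => by rw [Pi.single_eq_of_ne hj, smul_zero]) (by simp),
        Pi.single_eq_same]
    have hvφ : ∀ k, v (φ (Finsupp.single k 1)) =
        ∑ l, φ (Finsupp.single k 1) l • v (Finsupp.single l 1) := fun k => by
      conv_lhs => rw [← Finsupp.univ_sum_single (φ (Finsupp.single k 1)), map_sum]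
      refine Finset.sum_congr rfl fun l _ => ?_
      rw [← map_smul, Finsupp.smul_single, smul_eq_mul, mul_one]
    refine hcu ?_
    calc c u = ∑ k, evalMap (R := R) N (u k) (χ k) := hc u
      _ = ∑ k, ∑ l, v (Finsupp.single l 1) (MulOpposite.op (φ (Finsupp.single k 1) l) • χ k) := by
        refine Finset.sum_congr rfl fun k _ => ?_
        rw [hu, hvφ, LDual.sum_apply]
        rfl
      _ = ∑ l, v (Finsupp.single l 1) (∑ k, MulOpposite.op (φ (Finsupp.single k 1) l) • χ k) := by
        rw [Finset.sum_comm]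
        simp only [map_sum]
      _ = 0 := by simp only [hχ, map_zero, Finset.sum_const_zero]
  obtain ⟨y, hy⟩ := hmem
  refine ⟨evalMap N ∘ₗ Finsupp.linearCombination R y, LinearMap.ext fun x =>
    hδ.apply_apply_eq_zero _, ?_⟩
  ext1 k
  ext1
  have h1 : Finsupp.linearCombination R y (φ (Finsupp.single k 1)) = u k := by
    rw [← hy, Finsupp.linearCombination_apply, Finsupp.sum_fintype _ _ (by simp)]
    rfl
  simp [h1, hu]

variable (N) in
/-- The cokernel of the evaluation map. -/
abbrev EvalCoker : Type u := LDual R (RDual R N) ⧸ LinearMap.range (evalMap (R := R) N)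

/-- The character module of the cokernel of the evaluation map is a direct summand of the triple
character module. -/
theorem exists_retraction_EvalCoker :
    ∃ ρ : RDual R (LDual R (RDual R N)) →ₗ[Rᵐᵒᵖ] RDual R (EvalCoker (R := R) N),
      ∀ c, ρ (RDual.map (Submodule.mkQ _) c) = c := by
  let π : LDual R (RDual R N) →ₗ[R] EvalCoker (R := R) N := Submodule.mkQ _
  have hπ : Function.Surjective π := Submodule.mkQ_surjective _
  -- The transpose of the evaluation N → N⁺⁺ is split by the evaluation of N⁺. Subtracting the
  -- resulting projection from t leaves a character that kills N, hence one of the cokernel.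
  have key : ∀ t : RDual R (LDual R (RDual R N)), ∃ c : RDual R (EvalCoker (R := R) N),
      ∀ y, c (π y) = t y - y (RDual.map (evalMap N) t) := fun t => by
    let s : LDual R (RDual R N) →+ QZ := AddMonoidHom.mk'
      (fun y => t y - y (RDual.map (evalMap N) t)) fun y z => by
        rw [map_add, LDual.add_apply]; abel
    refine exists_character_factor (π.toAddMonoidHom) s fun y hy => ?_
    obtain ⟨x, rfl⟩ := (Submodule.Quotient.mk_eq_zero _).1 hy
    exact sub_self _
  choose ρ hρ using key
  refine ⟨⟨⟨ρ, fun s t => ?_⟩, fun r t => ?_⟩, fun c => ?_⟩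
  · ext z
    obtain ⟨y, rfl⟩ := hπ z
    rw [RDual.add_apply, hρ, hρ, hρ, map_add, map_add, RDual.add_apply]
    abel
  · ext z
    obtain ⟨y, rfl⟩ := hπ z
    rw [RingHom.id_apply, RDual.smul_apply, ← map_smul, hρ, hρ, map_smul]
    rfl
  · ext z
    obtain ⟨y, rfl⟩ := hπ z
    have : RDual.map (evalMap N) (RDual.map π c) = 0 := by
      ext x
      have : π (evalMap N x) = 0 := (Submodule.Quotient.mk_eq_zero _).2 ⟨x, rfl⟩
      simp [this]
    refine (hρ _ y).trans ?_
    rw [this, map_zero, sub_zero]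
    rfl

/-- Its character module is a summand of N⁺⁺⁺, which is injective because coherence makes N⁺⁺ flat.
-/
theorem isFlat_EvalCoker (hR : IsRightCoherent R) (hN : IsFlat R N) :
    IsFlat R (EvalCoker (R := R) N) := by
  rw [isFlat_iff_injective]
  have hinj := isFlat_iff_injective.1 (isFlat_LDual hR (isFlat_iff_injective.1 hN))
  obtain ⟨ρ, hρ⟩ := exists_retraction_EvalCoker (R := R) (N := N)
  refine ⟨fun A B _ _ _ _ f hf g => ?_⟩
  obtain ⟨h, hh⟩ := hinj.out f hf (RDual.map (Submodule.mkQ _) ∘ₗ g)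
  exact ⟨ρ ∘ₗ h, fun a => by simp [hh, hρ]⟩

end DoubleDual

/-! ### The pure exact coresolution by double character modules -/

section Coresolution

variable (F : Type u) [AddCommGroup F] [Module R F]

/-- The iterated cokernels of evaluation maps. -/
def pureSyzygy : ℕ → ModuleCat.{u} R
  | 0 => ModuleCat.of R F
  | j + 1 => ModuleCat.of R (EvalCoker (R := R) (pureSyzygy j))

/-- The terms of the pure exact complex `0 → F → F⁺⁺ → F₁⁺⁺ → F₂⁺⁺ → ⋯`. -/
def pureCoresolution : ℕ → ModuleCat.{u} R
  | 0 => ModuleCat.of R F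
  | j + 1 => ModuleCat.of R (LDual R (RDual R (pureSyzygy (R := R) F j)))

/-- The projection `F_j⁺⁺ → F_{j+1}`. -/
def pureProj (j : ℕ) :
    LDual R (RDual R (pureSyzygy (R := R) F j)) →ₗ[R] pureSyzygy (R := R) F (j + 1) :=
  Submodule.mkQ (LinearMap.range (evalMap (R := R) (pureSyzygy (R := R) F j)))

theorem exact_evalMap_pureProj (j : ℕ) :
    Function.Exact (evalMap (R := R) (pureSyzygy (R := R) F j)) (pureProj F j) :=
  LinearMap.exact_map_mkQ_range _

theorem pureProj_surjective (j : ℕ) : Function.Surjective (pureProj (R := R) F j) :=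
  Submodule.mkQ_surjective _

/-- The differential of the pure coresolution. -/
def pureDifferential :
    ∀ j, pureCoresolution (R := R) F j →ₗ[R] pureCoresolution (R := R) F (j + 1)
  | 0 => evalMap (R := R) (pureSyzygy (R := R) F 0)
  | j + 1 => evalMap (R := R) (pureSyzygy (R := R) F (j + 1)) ∘ₗ pureProj F j

theorem exact_evalMap_pureDifferential (j : ℕ) :
    Function.Exact (evalMap (R := R) (pureSyzygy (R := R) F j))
      (pureDifferential (R := R) F (j + 1)) := fun y =>
  Iff.trans (map_eq_zero_iff _ (evalMap_injective _)) (exact_evalMap_pureProj F j y)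

theorem exact_pureDifferential : ∀ j, Function.Exact (pureDifferential (R := R) F j)
    (pureDifferential (R := R) F (j + 1))
  | 0 => exact_evalMap_pureDifferential F 0
  | j + 1 => fun y => (exact_evalMap_pureDifferential F (j + 1) y).trans
      ⟨fun ⟨x, hx⟩ => by
        obtain ⟨z, rfl⟩ := pureProj_surjective F j x
        exact ⟨z, hx⟩, fun ⟨z, hz⟩ => ⟨pureProj F j z, hz⟩⟩

theorem hasPureKernel_pureDifferential : ∀ j, HasPureKernel (pureDifferential (R := R) F j)
  | 0 => hasPureKernel_of_injective _ (evalMap_injective _)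
  | j + 1 => hasPureKernel_of_exact_evalMap _ (exact_evalMap_pureDifferential F j)

theorem isFlat_pureSyzygy (hR : IsRightCoherent R) (hF : IsFlat R F) :
    ∀ j, IsFlat R (pureSyzygy (R := R) F j)
  | 0 => hF
  | j + 1 => isFlat_EvalCoker hR (isFlat_pureSyzygy hR hF j)

end Coresolution

/-! ### Exactness properties of complexes of projective modules -/

namespace ExactProjComplex

variable (C : ExactProjComplex R)

/-- The differential from degree `a` to degree `b`, when `a = b + 1`. -/
def dOf {a b : ℤ} (h : a = b + 1) : C.X a →ₗ[R] C.X b := by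
  subst h
  exact C.d b

theorem dOf_comp {a b c : ℤ} (h : a = b + 1) (h' : b = c + 1) : C.dOf h' ∘ₗ C.dOf h = 0 := by
  subst h'
  subst h
  exact LinearMap.ext (C.exact_d c).apply_apply_eq_zero

theorem homExact_iff (L : Type u) [AddCommGroup L] [Module R L] : C.HomExact L ↔
    ∀ i (g : C.X (i + 1) →ₗ[R] L), g ∘ₗ C.d (i + 1) = 0 → ∃ h : C.X i →ₗ[R] L, h ∘ₗ C.d i = g := by
  refine ⟨fun h i g hg => (h i g).1 hg, fun h i g => ⟨h i g, ?_⟩⟩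
  rintro ⟨k, rfl⟩
  exact LinearMap.ext fun x => by simp [(C.exact_d i).apply_apply_eq_zero x]

theorem tensorExact_iff (A : Type u) [AddCommGroup A] [Module Rᵐᵒᵖ A] :
    C.TensorExact A ↔ C.HomExact (LDual R A) := by
  rw [homExact_iff]
  exact forall_congr' fun i => exact_id_map_iff _ _ (C.exact_d i).apply_apply_eq_zero

variable {C}

theorem HomExact.exists_extension {L : Type u} [AddCommGroup L] [Module R L] (hC : C.HomExact L)
    {a b c : ℤ} (h : a = b + 1) (h' : b = c + 1) (g : C.X b →ₗ[R] L) (hg : g ∘ₗ C.dOf h = 0) :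
    ∃ t : C.X c →ₗ[R] L, t ∘ₗ C.dOf h' = g := by
  subst h'
  subst h
  exact (C.homExact_iff L).1 hC c g hg

/-- The degrees a j descend, turning the part of C from a 0 downwards into a complex indexed by ℕ.
Each map k j into Fⱼ extends, after evaluation, to t j into Fⱼ⁺⁺; projecting t j to the cokernel
gives k (j+1). Together g and the t j form the chain map to be contracted. -/
theorem exists_extension_of_pureCoresolution (F : Type u) [AddCommGroup F] [Module R F]
    (hC : ∀ j, C.HomExact (LDual R (RDual R (pureSyzygy (R := R) F j)))) (a : ℕ → ℤ)
    (ha : ∀ j, a j = a (j + 1) + 1) (g : C.X (a 0) →ₗ[R] F)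
    (hg : ∀ b (h : b = a 0 + 1), g ∘ₗ C.dOf h = 0) :
    ∃ s : C.X (a 1) →ₗ[R] F, s ∘ₗ C.dOf (ha 0) = g := by
  let P : ℕ → Type u := fun j => {k : C.X (a j) →ₗ[R] pureSyzygy (R := R) F j //
    ∀ b (h : b = a j + 1), k ∘ₗ C.dOf h = 0}
  have step : ∀ j (k : P j), ∃ t : C.X (a (j + 1)) →ₗ[R] LDual R (RDual R (pureSyzygy (R := R) F j)),
      t ∘ₗ C.dOf (ha j) = evalMap _ ∘ₗ k.1 := fun j k =>
    (hC j).exists_extension rfl (ha j) _ (by rw [LinearMap.comp_assoc, k.2, LinearMap.comp_zero])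
  choose t ht using step
  let next : ∀ j, P j → P (j + 1) := fun j k => ⟨pureProj F j ∘ₗ t j k, fun b h => by
    obtain rfl : b = a j := h.trans (ha j).symm
    rw [LinearMap.comp_assoc, ht]
    exact LinearMap.ext fun x => (exact_evalMap_pureProj F j).apply_apply_eq_zero _⟩
  let k : ∀ j, P j := fun j => Nat.rec ⟨g, hg⟩ next j
  let f : ∀ j, C.X (a j) →ₗ[R] pureCoresolution (R := R) F j
    | 0 => g
    | j + 1 => t j (k j)
  obtain ⟨s, hs⟩ := exists_homotopy_of_projective (pureDifferential (R := R) F)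
    (exact_pureDifferential F) (evalMap_injective _) (hasPureKernel_pureDifferential F)
    (X := fun j => C.X (a j)) (fun j => C.projective _) (fun j => C.dOf (ha j))
    (fun j => C.dOf_comp _ _) f (fun j => by
      cases j with
      | zero => exact ht 0 (k 0)
      | succ j => exact ht (j + 1) (k (j + 1)))
  exact ⟨s 0, (hs 0).symm⟩

/-- Over a right coherent ring, an exact complex of projective left modules stays exact under
`A ⊗_R -` for all injective `A` if and only if it stays exact under `Hom_R(-, F)` for all flat
`F`. -/
theorem tensorExact_injective_iff_homExact_flat (hR : IsRightCoherent R) (C : ExactProjComplex R) :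
    (∀ (A : Type u) [AddCommGroup A] [Module Rᵐᵒᵖ A], Module.Injective Rᵐᵒᵖ A → C.TensorExact A) ↔
      ∀ (F : Type u) [AddCommGroup F] [Module R F], IsFlat R F → C.HomExact F := by
  constructor
  · intro h F _ _ hF
    rw [homExact_iff]
    intro i g hg
    -- The degrees i+1, i, i−1, …; the first two are listed separately so that a 0 = a 1 + 1 holds
    -- by definition and `dOf` reduces to `C.d i`.
    let a : ℕ → ℤ
      | 0 => i + 1
      | 1 => i
      | j + 2 => i - (j + 1)
    have ha : ∀ j, a j = a (j + 1) + 1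
      | 0 => rfl
      | 1 => by simp [a]
      | j + 2 => by simp only [a]; push_cast; ring
    exact exists_extension_of_pureCoresolution F
      (fun j => (C.tensorExact_iff _).1 (h _ (isFlat_iff_injective.1 (isFlat_pureSyzygy F hR hF j))))
      a ha g (fun b hb => by subst hb; exact hg)
  · intro h A _ _ hA
    exact (C.tensorExact_iff A).2 (h _ (isFlat_LDual hR hA))

end ExactProjComplex

end DingPGF

theorem theorem2 (R : Type u) [Ring R] (hR : DingPGF.IsRightCoherent R) :
    DingPGF.DP R = DingPGF.PGF R ∧ DingPGF.PGF R = DingPGF.GPac R := by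
  have h := DingPGF.ExactProjComplex.tensorExact_injective_iff_homExact_flat hR
  refine ⟨Set.ext fun M => ?_, Set.ext fun M => ?_⟩
  · exact exists_congr fun C => and_congr_right fun _ => (h C).symm
  · refine exists_congr fun C => and_congr_right fun _ => (h C).trans ?_
    simp only [DingPGF.isLevel_iff_isFlat hR]
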